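/- Throughout, posets are finite. For $k\ge 3$ let $d_k(1)$ be the double-tailed diamond poset: it has $2k-2$ elements, namely a chain of $k-2$ elements, above it two incomparable elements, and above these a chain of $k-2$ elements. In a poset $P$, an interval $[v,u]$ isomorphic to $d_k(1)$ is called a $d_k$-interval, and a convex subset isomorphic to $d_k(1)$ with its top element removed is called a $d_k^-$-interval. $P$ is $d$-complete if for all $k\ge 3$: (D1) for every $d_k^-$-interval $A$ there is an element $u$ covering the maximal elements of $A$ such that $A\cup\{u\}$ is a $d_k$-interval; (D2) if $[v,u]$ is a $d_k$-interval and $u$ covers $u'$, then $u'\in[v,u]$; (D3) no two distinct $d_k^-$-intervals differ only in their minimal elements. The top forest $\Gamma$ of $P$ consists of those $x$ such that every $y\ge x$ is covered by at most one element; its Hasse diagram is regarded as a Dynkin diagram. A $d$-complete coloring is a map $c:P\to I$ that restricts to a bijection $\Gamma\to I$ and satisfies: incomparable elements have different colors; the colors of the elements of an interval that is a chain are distinct; and $c(v)=c(u)$ for every $d_k$-interval $[v,u]$. For $i\in I$ let $N_i$ be the set of $x\in P$ whose color $c(x)$ is adjacent to $i$ in $\Gamma$ (with $I$ identified with $\Gamma$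 through $c$). For $D\subseteq P$, an element $u\in D$ is $D$-active if there is $v\in P\setminus D$ with $v<u$ and $c(v)=c(u)$ such that $[v,u]$ is a $d_k$-interval for some $k\ge 3$ and $[v,u]\cap D\cap N_{c(u)}=\emptyset$. In that case put $\alpha_u(D)=(D\setminus\{u\})\cup\{v\}$ (ordinary elementary excitation) and $\alpha^*_u(D)=D\cup\{v\}$ ($K$-theoretical elementary excitation). For an order filter $F$ of $P$, let $\mathcal E_P(F)$ be the set of excited diagrams, i.e. subsets obtained from $F$ by a (possibly empty) sequence of ordinary elementary excitations, and let $\mathcal E^*_P(F)$ be the set of $K$-theoretical excited diagrams, i.e. subsets obtained from $F$ by a (possibly empty) sequence of ordinary and $K$-theoretical elementary excitations. The set $B(D)$ of excited peaks of $D\in\mathcal E_P(F)$ is defined recursively by $B(F)=\emptyset$ and $$B(\alpha_u(D))=\bigl(B(D)\setminus([v,u]\cap N_{c(u)})\bigr)\cup\{u\}.$$ **Proposition.** Let $P$ be a connected $d$-complete poset with $d$-complete coloring $c$, and let $F$ be an order filter of $P$. Then for every $D\in\mathcal E_P(F)$ the set $B(D)$ is well defined (independent of the sequence of ordinary elementary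 excitations leading from $F$ to $D$) and disjoint from $D$, and $$\mathcal E^*_P(F)=\bigsqcup_{D\in\mathcal E_P(F)}\{D\sqcup S : S\subseteq B(D)\},$$ where the union on the right-hand side is disjoint. -/

import Mathlib

namespace DComplete

/-- Underlying set of the double-tailed diamond `d_k(1)` (`k ≥ 3`), with `2k - 2` elements: a lower
chain of `k - 2` elements, two incomparable middle elements, an upper chain of `k - 2` elements. -/
inductive Diamond (k : ℕ) : Type
  | tail (i : Fin (k - 2)) : Diamond k
  | mid (b : Bool) : Diamond k
  | neck (i : Fin (k - 2)) : Diamond k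

/-- The height of an element of the double-tailed diamond above the bottom element. -/
def Diamond.level {k : ℕ} : Diamond k → ℕ
  | .tail i => i
  | .mid _ => k - 2
  | .neck i => k - 1 + i

/-- `x ≤ y` iff `x = y` or `x` lies on a strictly lower level; only the two middle elements
share a level. -/
instance (k : ℕ) : PartialOrder (Diamond k) where
  le x y := x = y ∨ x.level < y.level
  le_refl _ := Or.inl rfl
  le_trans x y z := by
    rintro (rfl | h) (rfl | h')
    · exact Or.inl rfl
    · exact Or.inr h'
    · exact Or.inr h
    · exact Or.inr (h.trans h')
  le_antisymm x y := by
    rintro (rfl | h) (h' | h')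
    · rfl
    · rfl
    · exact h'.symm
    · exact absurd (h.trans h') (lt_irrefl _)

variable {P : Type*} [PartialOrder P]

/-- `[v, u]` is a `d_k`-interval. -/
def IsDkInterval (k : ℕ) (v u : P) : Prop :=
  Nonempty (Set.Icc v u ≃o Diamond k)

/-- `A` is a `d_k^-`-interval: a convex subset isomorphic to `d_k(1)` with its top element removed.
For `k ≥ 4` such an `A` is an interval of `P`; for `k = 3` it consists of
three elements `w, x, y` such that `w` is covered by `x` and by `y`, where `x ≠ y`. -/
def IsDkMinus (k : ℕ) (A : Set P) : Prop :=
  A.OrdConnected ∧ Nonempty (A ≃o {x : Diamond k // ¬ IsMax x})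

variable (P) in
/-- `d`-complete posets (finiteness is imposed separately). -/
structure IsDComplete : Prop where
  /-- Every `d_k^-`-interval is completed to a `d_k`-interval by an element covering its
  maximal elements. -/
  d1 : ∀ k, 3 ≤ k → ∀ A : Set P, IsDkMinus k A →
    ∃ u, (∀ x, Maximal (· ∈ A) x → x ⋖ u) ∧
      ∃ v, insert u A = Set.Icc v u ∧ IsDkInterval k v u
  /-- The top of a `d_k`-interval covers only elements of that interval. -/
  d2 : ∀ k, 3 ≤ k → ∀ v u : P, IsDkInterval k v u → ∀ u', u' ⋖ u → u' ∈ Set.Icc v u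
  /-- No two distinct `d_k^-`-intervals differ only in their minimal elements. -/
  d3 : ∀ k, 3 ≤ k → ∀ A A' : Set P, IsDkMinus k A → IsDkMinus k A' →
    ∀ v v', IsLeast A v → IsLeast A' v' → A \ {v} = A' \ {v'} → v = v'

variable (P) in
/-- The top forest of `P`: the elements `x` such that every `y ≥ x` is covered by at most one
element. -/
def topForest : Set P :=
  {x | ∀ y, x ≤ y → ∀ z z', y ⋖ z → y ⋖ z' → z = z'}

variable {I : Type*}

/-- `c : P → I` is a `d`-complete coloring. -/
structure IsDCompleteColoring (c : P → I) : Prop where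
  /-- The colors are in bijection with the top forest. -/
  bijOn_topForest : Set.BijOn c (topForest P) Set.univ
  /-- Incomparable elements have different colors. -/
  incomparable : ∀ x y, ¬ x ≤ y → ¬ y ≤ x → c x ≠ c y
  /-- The colors in an interval that is a chain are distinct. -/
  chain : ∀ v u : P, IsChain (· ≤ ·) (Set.Icc v u) → Set.InjOn c (Set.Icc v u)
  /-- The top and the bottom of a `d_k`-interval have the same color. -/
  interval : ∀ k, 3 ≤ k → ∀ v u : P, IsDkInterval k v u → c v = c u

/-- Adjacency of colors in the Dynkin diagram, that is, in the Hasse diagram of the top forest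
(an upper set of `P`, so that its covering relation is that of `P`) relabelled by `c`. -/
def ColorAdj (c : P → I) (i j : I) : Prop :=
  ∃ x ∈ topForest P, ∃ y ∈ topForest P, c x = i ∧ c y = j ∧ (x ⋖ y ∨ y ⋖ x)

/-- `N_i`, the set of elements whose color is adjacent to `i`. -/
def nbr (c : P → I) (i : I) : Set P :=
  {x | ColorAdj c (c x) i}

/-- `u` is `D`-active, and `v` is the bottom element of the `d_k`-interval with top `u`
that witnesses this. -/
structure IsActive (c : P → I) (D : Set P) (u v : P) : Prop where
  mem : u ∈ D
  not_mem : v ∉ D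
  color : c v = c u
  lt : v < u
  interval : ∃ k, 3 ≤ k ∧ IsDkInterval k v u
  inter_eq : Set.Icc v u ∩ D ∩ nbr c (c u) = ∅

/-- `D'` is obtained from `D` by an ordinary elementary excitation: `D' = α_u(D)`. -/
def Excitation (c : P → I) (D D' : Set P) : Prop :=
  ∃ u v, IsActive c D u v ∧ D' = insert v (D \ {u})

/-- `D'` is obtained from `D` by a `K`-theoretical elementary excitation: `D' = α*_u(D)`. -/
def KExcitation (c : P → I) (D D' : Set P) : Prop :=
  ∃ u v, IsActive c D u v ∧ D' = insert v D

/-- The set of excited diagrams of `F` in `P`. -/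
def excitedDiagrams (c : P → I) (F : Set P) : Set (Set P) :=
  {D | Relation.ReflTransGen (Excitation c) F D}

/-- The set of `K`-theoretical excited diagrams of `F` in `P`. -/
def kExcitedDiagrams (c : P → I) (F : Set P) : Set (Set P) :=
  {D | Relation.ReflTransGen (fun D₁ D₂ => Excitation c D₁ D₂ ∨ KExcitation c D₁ D₂) F D}

/-- `IsPeakSet c F D B`: some sequence of elementary excitations leads from `F` to `D`, and the
recursion for excited peaks along that sequence, started at `∅`, yields `B`. -/
inductive IsPeakSet (c : P → I) (F : Set P) : Set P → Set P → Prop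
  | base : IsPeakSet c F F ∅
  | step {D B : Set P} {u v : P} : IsPeakSet c F D B → IsActive c D u v →
      IsPeakSet c F (insert v (D \ {u})) ((B \ (Set.Icc v u ∩ nbr c (c u))) ∪ {u})

/-- `B(D)`, the set of excited peaks of `D`: the set `B` with `IsPeakSet c F D B`, written as the
union of all such `B`; that there is exactly one for an excited diagram `D` is part of the
theorem. -/
def excitedPeaks (c : P → I) (F D : Set P) : Set P :=
  ⋃₀ {B | IsPeakSet c F D B}

end DComplete

namespace DComplete

/-! The recursion for peaks has a closed form: `B(D)` is `vacated c D`, the positions outside `D`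
lying above an element of `D` of the same color with no element of `D` of an adjacent color between.
This depends on `D` alone and is visibly disjoint from `D`. The induction (`vacated_excitation`)
needs the invariant `IsSeparated` of excited diagrams.

Both rest on one property of the poset: elements of adjacent colors are comparable
(`comparable_of_colorAdj`). So an element of an adjacent color in `D` is never beside a slide from
`u` to `v`: it is above `u` or below `v`. Comparability is proved by climbing: an element outside
the top forest is the bottom of a `d_k`-interval whose top has the same color, and inside the top
forest adjacency is covering.

In `D ∪ S` with `S` a set of peaks, moving an element of `D` excites `D`, the K-move keeping the old
position as a peak; moving an element of `S` changes only `S`. Replaying the excitations of `D`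
gives the converse. The union determines `D` from the bottom up: a peak sees an element of its color
below it unobstructed, an element of `D` never does. -/

/-! ### Double-tailed diamonds -/

theorem Diamond.lt_iff {k : ℕ} {x y : Diamond k} : x < y ↔ x.level < y.level := by
  rw [lt_iff_le_not_ge]
  constructor
  · rintro ⟨rfl | h, h'⟩
    · exact absurd (le_refl _) h'
    · exact h
  · intro h
    refine ⟨Or.inr h, ?_⟩
    rintro (rfl | h')
    · exact lt_irrefl _ h
    · exact lt_asymm h h'

theorem Diamond.le_iff {k : ℕ} {x y : Diamond k} : x ≤ y ↔ x = y ∨ x.level < y.level := Iff.rfl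

theorem Diamond.eq_of_level_eq {k : ℕ} {x y : Diamond k} (h : x.level = y.level)
    (hx : x.level ≠ k - 2) : x = y := by
  cases x <;> cases y <;> simp only [Diamond.level, ne_eq, not_true_eq_false] at h hx
  · congr 1; ext; exact h
  · omega
  · omega
  · omega
  · omega
  · congr 1; ext; omega

/-- The embedding of the smaller diamond as the middle part of the bigger one. -/
def Diamond.lift {k : ℕ} : Diamond k → Diamond (k + 1)
  | .tail i => .tail ⟨i + 1, by omega⟩
  | .mid b => .mid b
  | .neck i => .neck ⟨i, by omega⟩

theorem Diamond.level_lift {k : ℕ} (hk : 2 ≤ k) (x : Diamond k) :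
    x.lift.level = x.level + 1 := by
  cases x <;> simp only [Diamond.lift, Diamond.level] <;> omega

theorem Diamond.lift_injective {k : ℕ} : Function.Injective (Diamond.lift (k := k)) := by
  intro x y h
  cases x <;> cases y <;> simp_all [Diamond.lift, Fin.ext_iff]

theorem Diamond.lift_le_lift {k : ℕ} (hk : 2 ≤ k) {x y : Diamond k} :
    x.lift ≤ y.lift ↔ x ≤ y := by
  simp only [Diamond.le_iff, Diamond.level_lift hk, Diamond.lift_injective.eq_iff,
    Nat.add_lt_add_iff_right]

theorem Diamond.exists_lift {k : ℕ} (hk : 3 ≤ k) {x : Diamond (k + 1)} (h0 : x.level ≠ 0)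
    (h1 : x.level < 2 * k - 2) : ∃ y : Diamond k, y.lift = x := by
  cases x with
  | tail i =>
    simp only [Diamond.level] at h0
    exact ⟨.tail ⟨i - 1, by omega⟩, by simp only [Diamond.lift]; congr 1; ext; simp only; omega⟩
  | mid b => exact ⟨.mid b, rfl⟩
  | neck i =>
    simp only [Diamond.level] at h1
    exact ⟨.neck ⟨i, by omega⟩, rfl⟩

theorem Diamond.level_le {k : ℕ} (hk : 3 ≤ k) (x : Diamond k) : x.level ≤ 2 * k - 4 := by
  cases x <;> simp only [Diamond.level] <;> omega

theorem Diamond.exists_level {k : ℕ} (hk : 3 ≤ k) {n : ℕ} (hn : n ≤ 2 * k - 4) :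
    ∃ x : Diamond k, x.level = n := by
  rcases lt_trichotomy n (k - 2) with h | h | h
  · exact ⟨.tail ⟨n, h⟩, rfl⟩
  · exact ⟨.mid true, h.symm⟩
  · exact ⟨.neck ⟨n - (k - 1), by omega⟩, by simp only [Diamond.level]; omega⟩

theorem Diamond.isMax_iff {k : ℕ} (hk : 3 ≤ k) {x : Diamond k} :
    IsMax x ↔ x.level = 2 * k - 4 := by
  obtain ⟨t, ht⟩ := Diamond.exists_level hk (le_refl (2 * k - 4))
  have := Diamond.level_le hk x
  constructor
  · intro h
    by_contra hne
    exact h.not_lt (b := t) (Diamond.lt_iff.2 (by omega))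
  · intro h y hy
    have := Diamond.level_le hk y
    rcases Diamond.le_iff.1 hy with rfl | h'
    · exact le_rfl
    · omega

/-! ### Diamond intervals inside a poset -/

variable {P : Type*} [PartialOrder P]

theorem isDkInterval_iff {k : ℕ} {v u : P} :
    IsDkInterval k v u ↔ ∃ g : Diamond k ↪o P, Set.range g = Set.Icc v u := by
  constructor
  · rintro ⟨e⟩
    refine ⟨e.symm.toOrderEmbedding.trans (OrderEmbedding.subtype _), ?_⟩
    ext x
    constructor
    · rintro ⟨d, rfl⟩
      exact (e.symm d).2
    · intro hx
      exact ⟨e ⟨x, hx⟩, by simp⟩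
  · rintro ⟨g, hg⟩
    exact ⟨((OrderEmbedding.orderIso (f := g)).trans (OrderIso.setCongr _ _ hg)).symm⟩

theorem isDkMinus_of_embedding {k : ℕ} {A : Set P} (hA : A.OrdConnected)
    (g : {x : Diamond k // ¬ IsMax x} ↪o P) (hg : Set.range g = A) : IsDkMinus k A :=
  ⟨hA, ⟨((OrderEmbedding.orderIso (f := g)).trans (OrderIso.setCongr _ _ hg)).symm⟩⟩

theorem apply_eq_bot {k : ℕ} {v u : P} (g : Diamond k ↪o P) (hg : Set.range g = Set.Icc v u)
    {d : Diamond k} (hd : d.level = 0) : g d = v := by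
  have hmem : g d ∈ Set.Icc v u := hg ▸ Set.mem_range_self d
  have hv : v ∈ Set.range g := hg ▸ ⟨le_rfl, hmem.1.trans hmem.2⟩
  obtain ⟨d', rfl⟩ := hv
  have := g.le_iff_le.1 hmem.1
  rcases Diamond.le_iff.1 this with rfl | h
  · rfl
  · omega

theorem apply_eq_top {k : ℕ} (hk : 3 ≤ k) {v u : P} (g : Diamond k ↪o P)
    (hg : Set.range g = Set.Icc v u) {d : Diamond k} (hd : d.level = 2 * k - 4) : g d = u := by
  have hmem : g d ∈ Set.Icc v u := hg ▸ Set.mem_range_self d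
  have hu : u ∈ Set.range g := hg ▸ ⟨hmem.1.trans hmem.2, le_rfl⟩
  obtain ⟨d', rfl⟩ := hu
  have := g.le_iff_le.1 hmem.2
  have := Diamond.level_le hk d'
  rcases Diamond.le_iff.1 ‹d ≤ d'› with rfl | h
  · rfl
  · omega

theorem apply_covBy {k : ℕ} {v u : P} (g : Diamond k ↪o P) (hg : Set.range g = Set.Icc v u)
    {d d' : Diamond k} (h : d'.level = d.level + 1) : g d ⋖ g d' := by
  refine ⟨g.lt_iff_lt.2 (Diamond.lt_iff.2 (by omega)), ?_⟩
  intro z h1 h2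
  have hz : z ∈ Set.range g := by
    rw [hg]
    have m1 : g d ∈ Set.Icc v u := hg ▸ Set.mem_range_self d
    have m2 : g d' ∈ Set.Icc v u := hg ▸ Set.mem_range_self d'
    exact ⟨m1.1.trans h1.le, h2.le.trans m2.2⟩
  obtain ⟨e, rfl⟩ := hz
  have := Diamond.lt_iff.1 (g.lt_iff_lt.1 h1)
  have := Diamond.lt_iff.1 (g.lt_iff_lt.1 h2)
  omega

theorem level_of_covBy {k : ℕ} (hk : 3 ≤ k) (g : Diamond k ↪o P)
    {d d' : Diamond k} (h : g d ⋖ g d') : d'.level = d.level + 1 := by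
  have h1 := Diamond.lt_iff.1 (g.lt_iff_lt.1 h.lt)
  by_contra hne
  have := Diamond.level_le hk d'
  obtain ⟨e, he⟩ := Diamond.exists_level hk (n := d.level + 1) (by omega)
  exact h.2 (g.lt_iff_lt.2 (Diamond.lt_iff.2 (show d.level < e.level by omega)))
    (g.lt_iff_lt.2 (Diamond.lt_iff.2 (by omega)))

theorem IsDkInterval.lt {k : ℕ} (hk : 3 ≤ k) {v u : P} (h : IsDkInterval k v u) : v < u := by
  obtain ⟨g, hg⟩ := isDkInterval_iff.1 h
  obtain ⟨b, hb⟩ := Diamond.exists_level hk (Nat.zero_le (2 * k - 4))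
  obtain ⟨t, ht⟩ := Diamond.exists_level hk (le_refl (2 * k - 4))
  rw [← apply_eq_bot g hg hb, ← apply_eq_top hk g hg ht, g.lt_iff_lt, Diamond.lt_iff]
  omega

theorem isChain_image_diamond {k : ℕ} (g : Diamond k ↪o P) {s : Set (Diamond k)}
    (hs : ∀ x ∈ s, ∀ y ∈ s, x.level = k - 2 → y.level = k - 2 → x = y) :
    IsChain (· ≤ ·) (g '' s) := by
  rintro _ ⟨x, hx, rfl⟩ _ ⟨y, hy, rfl⟩ -
  simp only [g.le_iff_le]
  rcases lt_trichotomy x.level y.level with h | h | h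
  · exact Or.inl (Or.inr h)
  · refine Or.inl (Or.inl ?_)
    by_cases hm : x.level = k - 2
    · exact hs x hx y hy hm (h ▸ hm)
    · exact Diamond.eq_of_level_eq h hm
  · exact Or.inr (Or.inr h)

/-- Every element of a double-tailed diamond splits it so that one side is a chain. -/
theorem IsDkInterval.isChain_or {k : ℕ} {v u w : P} (h : IsDkInterval k v u)
    (hw : w ∈ Set.Icc v u) :
    IsChain (· ≤ ·) (Set.Icc v w) ∨ IsChain (· ≤ ·) (Set.Icc w u) := by
  obtain ⟨g, hg⟩ := isDkInterval_iff.1 h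
  obtain ⟨d, rfl⟩ : w ∈ Set.range g := hg ▸ hw
  rcases le_total d.level (k - 2) with hd | hd
  · left
    refine (isChain_image_diamond g (s := {x | x ≤ d}) ?_).mono ?_
    · rintro x (rfl | hx) y (rfl | hy) h1 h2
      · rfl
      all_goals omega
    · intro x hx
      obtain ⟨e, rfl⟩ : x ∈ Set.range g := hg ▸ ⟨hx.1, hx.2.trans hw.2⟩
      exact ⟨e, g.le_iff_le.1 hx.2, rfl⟩
  · right
    refine (isChain_image_diamond g (s := {x | d ≤ x}) ?_).mono ?_
    · rintro x (rfl | hx) y (rfl | hy) h1 h2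
      · rfl
      all_goals omega
    · intro x hx
      obtain ⟨e, rfl⟩ : x ∈ Set.range g := hg ▸ ⟨hw.1.trans hx.1, hx.2⟩
      exact ⟨e, g.le_iff_le.1 hx.1, rfl⟩

/-- An atom `x` and a coatom `w` of a double-tailed diamond `[v, u]` either complete a rank two
interval or bound a smaller double-tailed diamond. -/
theorem IsDkInterval.peel {k : ℕ} (hk : 3 ≤ k) {v u x w : P} (h : IsDkInterval k v u)
    (hvx : v ⋖ x) (hxu : x ≤ u) (hvw : v ≤ w) (hwu : w ⋖ u) :
    (x ⋖ u ∧ v ⋖ w) ∨ ∃ l, 3 ≤ l ∧ IsDkInterval l x w := by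
  obtain ⟨g, hg⟩ := isDkInterval_iff.1 h
  obtain ⟨b, hb⟩ := Diamond.exists_level hk (Nat.zero_le (2 * k - 4))
  obtain ⟨t, ht⟩ := Diamond.exists_level hk (le_refl (2 * k - 4))
  have hv := apply_eq_bot g hg hb
  have hu := apply_eq_top hk g hg ht
  obtain ⟨x, rfl⟩ : x ∈ Set.range g := hg ▸ ⟨hvx.le, hxu⟩
  obtain ⟨w, rfl⟩ : w ∈ Set.range g := hg ▸ ⟨hvw, hwu.le⟩
  have hx := level_of_covBy hk g (hv.symm ▸ hvx)
  have hw := level_of_covBy hk g (hu.symm ▸ hwu)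
  -- For `k = 3` atoms and coatoms are the middle elements. Otherwise, removing both ends leaves a
  -- lifted copy of `Diamond l`.
  obtain rfl | ⟨l, rfl, hl⟩ : k = 3 ∨ ∃ l, k = l + 1 ∧ 3 ≤ l := by
    rcases eq_or_lt_of_le hk with h | h
    · exact Or.inl h.symm
    · exact Or.inr ⟨k - 1, by omega, by omega⟩
  · left
    rw [← hv, ← hu]
    exact ⟨apply_covBy g hg (by omega), apply_covBy g hg (by omega)⟩
  · right
    refine ⟨l, hl, isDkInterval_iff.2 ⟨(OrderEmbedding.ofMapLEIff Diamond.lift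
      (fun _ _ => Diamond.lift_le_lift (by omega))).trans g, ?_⟩⟩
    ext z
    simp only [Set.mem_range, RelEmbedding.coe_trans, Function.comp_apply,
      OrderEmbedding.coe_ofMapLEIff]
    constructor
    · rintro ⟨d, rfl⟩
      have h1 := Diamond.level_lift (by omega) d
      have h2 := Diamond.level_le hl d
      constructor
      · rw [g.le_iff_le, Diamond.le_iff]
        by_cases h0 : d.level = 0
        · exact Or.inl (Diamond.eq_of_level_eq (by omega) (by omega))
        · exact Or.inr (by omega)
      · rw [g.le_iff_le, Diamond.le_iff]
        by_cases h0 : d.level = 2 * l - 4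
        · exact Or.inl (Diamond.eq_of_level_eq (by omega) (by omega))
        · exact Or.inr (by omega)
    · rintro ⟨h1, h2⟩
      obtain ⟨d, rfl⟩ : z ∈ Set.range g := hg ▸ ⟨hvx.le.trans h1, h2.trans hwu.le⟩
      rw [g.le_iff_le, Diamond.le_iff] at h1 h2
      have a1 : d.level ≠ 0 := by rcases h1 with rfl | h1 <;> omega
      have a2 : d.level < 2 * l - 2 := by rcases h2 with rfl | h2 <;> omega
      obtain ⟨e, rfl⟩ := Diamond.exists_lift hl a1 a2
      exact ⟨e, rfl⟩

/-- An element with two upper covers forms with them a `d_3^-`-interval. -/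
theorem isDkMinus_three {y x x' : P} (h : y ⋖ x) (h' : y ⋖ x') (hne : x ≠ x') :
    IsDkMinus 3 {y, x, x'} := by
  have n1 : ¬ x ≤ x' := fun hle => h'.2 h.lt (lt_of_le_of_ne hle hne)
  have n2 : ¬ x' ≤ x := fun hle => h.2 h'.lt (lt_of_le_of_ne hle hne.symm)
  have n3 : ¬ x ≤ y := h.lt.not_ge
  have n4 : ¬ x' ≤ y := h'.lt.not_ge
  have hmax : ∀ i, IsMax (Diamond.neck (k := 3) i) := fun i =>
    (Diamond.isMax_iff le_rfl).2 (by simp [Diamond.level])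
  have hmid : ∀ b, ¬ IsMax (Diamond.mid (k := 3) b) := fun i hi => by
    simpa [Diamond.level] using (Diamond.isMax_iff le_rfl).1 hi
  have htail : ∀ b, ¬ IsMax (Diamond.tail (k := 3) b) := fun i hi => by
    simpa [Diamond.level] using (Diamond.isMax_iff le_rfl).1 hi
  let f : Diamond 3 → P := fun d => match d with
    | .tail _ => y
    | .mid b => if b then x else x'
    | .neck _ => y
  refine isDkMinus_of_embedding ⟨?_⟩
    (OrderEmbedding.ofMapLEIff (fun d => f d.1) ?_) ?_
  · have key : ∀ a ∈ ({y, x, x'} : Set P), ∀ z, y ≤ z → z ≤ a → z ∈ ({y, x, x'} : Set P) := by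
      rintro a (rfl | rfl | rfl) z h1 h2
      · exact Or.inl (le_antisymm h2 h1)
      · rcases h.eq_or_eq h1 h2 with rfl | rfl <;> simp
      · rcases h'.eq_or_eq h1 h2 with rfl | rfl <;> simp
    rintro a ha b hb z ⟨h1, h2⟩
    refine key b hb z (le_trans ?_ h1) h2
    rcases ha with rfl | rfl | rfl
    · exact le_rfl
    · exact h.le
    · exact h'.le
  · rintro ⟨d, hd⟩ ⟨d', hd'⟩
    rw [Subtype.mk_le_mk, Diamond.le_iff]
    cases d with
    | neck i => exact absurd (hmax i) hd
    | tail i =>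
      cases d' with
      | neck i => exact absurd (hmax i) hd'
      | tail j =>
        have : i = j := by ext; omega
        simp [f, this]
      | mid b => cases b <;> simp [f, Diamond.level, h.le, h'.le]
    | mid b =>
      cases d' with
      | neck i => exact absurd (hmax i) hd'
      | tail j => cases b <;> simp [f, Diamond.level, n3, n4]
      | mid b' => cases b <;> cases b' <;> simp [f, Diamond.level, n1, n2]
  · ext z
    simp only [OrderEmbedding.coe_ofMapLEIff, Set.mem_range, Subtype.exists, Set.mem_insert_iff,
      Set.mem_singleton_iff]
    constructor
    · rintro ⟨d, hd, rfl⟩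
      cases d with
      | neck i => exact absurd (hmax i) hd
      | tail i => simp [f]
      | mid b => cases b <;> simp [f]
    · rintro (rfl | rfl | rfl)
      · exact ⟨.tail ⟨0, by omega⟩, htail _, rfl⟩
      · exact ⟨.mid true, hmid _, rfl⟩
      · exact ⟨.mid false, hmid _, rfl⟩

/-- Prolonging a `d_k`-interval at the bottom by an element with a single upper cover gives a
`d_{k+1}^-`-interval. -/
theorem IsDkInterval.isDkMinus_succ {k : ℕ} (hk : 3 ≤ k) {y v u : P} (h : IsDkInterval k v u)
    (hyv : y ⋖ v) (hy : ∀ z, y < z → v ≤ z) : IsDkMinus (k + 1) (Set.Icc y u) := by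
  obtain ⟨g, hg⟩ := isDkInterval_iff.1 h
  classical
  have hlift : ∀ d : {x : Diamond (k + 1) // ¬ IsMax x}, d.1.level ≠ 0 →
      ∃ e : Diamond k, e.lift = d.1 := fun d hd => by
    refine Diamond.exists_lift hk hd ?_
    have h1 := Diamond.level_le (by omega) d.1
    have h2 := d.2
    rw [Diamond.isMax_iff (by omega)] at h2
    omega
  have hgv : ∀ d, v ≤ g d := fun d => (hg ▸ Set.mem_range_self d : g d ∈ Set.Icc v u).1
  have hgu : ∀ d, g d ≤ u := fun d => (hg ▸ Set.mem_range_self d : g d ∈ Set.Icc v u).2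
  -- Without its top, `Diamond (k + 1)` is a bottom element, sent to `y`, below a lifted copy of
  -- `Diamond k`, sent to `[v, u]`.
  let f : {x : Diamond (k + 1) // ¬ IsMax x} → P := fun d =>
    if hd : d.1.level = 0 then y else g (hlift d hd).choose
  have hf0 : ∀ d, d.1.level = 0 → f d = y := fun d hd => dif_pos hd
  have hf1 : ∀ d (e : Diamond k), e.lift = d.1 → f d = g e := fun d e he => by
    have hd : d.1.level ≠ 0 := by rw [← he, Diamond.level_lift (by omega)]; omega
    simp only [f, dif_neg hd]
    congr 1
    exact Diamond.lift_injective ((hlift d hd).choose_spec.trans he.symm)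
  refine isDkMinus_of_embedding Set.ordConnected_Icc (OrderEmbedding.ofMapLEIff f ?_) ?_
  · intro d d'
    rw [← Subtype.coe_le_coe]
    by_cases hd : d.1.level = 0
    · rw [hf0 d hd, Diamond.le_iff]
      by_cases hd' : d'.1.level = 0
      · rw [hf0 d' hd']
        exact iff_of_true le_rfl (Or.inl (Diamond.eq_of_level_eq (by omega) (by omega)))
      · obtain ⟨e, he⟩ := hlift d' hd'
        rw [hf1 d' e he]
        exact iff_of_true (hyv.le.trans (hgv e)) (Or.inr (by omega))
    · obtain ⟨e, he⟩ := hlift d hd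
      rw [hf1 d e he]
      by_cases hd' : d'.1.level = 0
      · rw [hf0 d' hd', Diamond.le_iff]
        refine iff_of_false (fun hle => hyv.lt.not_ge ((hgv e).trans hle)) ?_
        rintro (heq | hlt)
        · rw [heq] at hd; exact hd hd'
        · omega
      · obtain ⟨e', he'⟩ := hlift d' hd'
        rw [hf1 d' e' he', g.le_iff_le, ← he, ← he', Diamond.lift_le_lift (by omega)]
  · ext z
    simp only [OrderEmbedding.coe_ofMapLEIff, Set.mem_range]
    constructor
    · rintro ⟨d, rfl⟩
      by_cases hd : d.1.level = 0
      · rw [hf0 d hd]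
        exact ⟨le_rfl, hyv.le.trans (h.lt hk).le⟩
      · obtain ⟨e, he⟩ := hlift d hd
        rw [hf1 d e he]
        exact ⟨hyv.le.trans (hgv e), hgu e⟩
    · rintro ⟨h1, h2⟩
      rcases eq_or_lt_of_le h1 with rfl | h1
      · obtain ⟨b, hb⟩ := Diamond.exists_level (k := k + 1) (by omega) (Nat.zero_le _)
        exact ⟨⟨b, by rw [Diamond.isMax_iff (by omega)]; omega⟩, hf0 _ hb⟩
      · obtain ⟨e, rfl⟩ : z ∈ Set.range g := hg ▸ ⟨hy z h1, h2⟩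
        refine ⟨⟨e.lift, ?_⟩, hf1 _ e rfl⟩
        have := Diamond.level_le hk e
        rw [Diamond.isMax_iff (by omega), Diamond.level_lift (by omega)]
        omega

variable {I : Type*}

theorem topForest_isUpperSet : IsUpperSet (topForest P) :=
  fun _ _ hab ha y hy => ha y (hab.trans hy)

theorem ColorAdj.symm {c : P → I} {i j : I} (h : ColorAdj c i j) : ColorAdj c j i := by
  obtain ⟨x, hx, y, hy, h1, h2, h3⟩ := h
  exact ⟨y, hy, x, hx, h2, h1, h3.symm⟩

/-! ### Diamonds above elements outside the top forest -/

namespace IsDComplete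

variable (hP : IsDComplete P)
include hP

theorem exists_isDkInterval_of_covBy_covBy {y x x' : P} (h : y ⋖ x) (h' : y ⋖ x') (hne : x ≠ x') :
    ∃ u, IsDkInterval 3 y u ∧ x ≤ u := by
  obtain ⟨u, -, v, hv, hd⟩ := hP.d1 3 le_rfl _ (isDkMinus_three h h' hne)
  have hy : y ∈ Set.Icc v u := hv ▸ by simp
  have hx : x ∈ Set.Icc v u := hv ▸ by simp
  have hvm : v ∈ insert u ({y, x, x'} : Set P) := hv ▸ ⟨le_rfl, hy.1.trans hy.2⟩
  have hyv : y ≤ v := by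
    -- (D1) does not name the bottom `v`, but every candidate lies above `y`.
    rcases hvm with rfl | rfl | rfl | rfl
    · exact hy.2
    · exact le_rfl
    · exact h.le
    · exact h'.le
  obtain rfl := le_antisymm hyv hy.1
  exact ⟨u, hd, hx.2⟩

variable [Finite P]

/-- Every element outside the top forest is the bottom of a `d_k`-interval. -/
theorem exists_isDkInterval {a : P} (ha : a ∉ topForest P) :
    ∃ k, 3 ≤ k ∧ ∃ u, IsDkInterval k a u := by
  induction a using WellFoundedGT.induction with
  | ind a ih =>
  by_cases h2 : ∃ x x', a ⋖ x ∧ a ⋖ x' ∧ x ≠ x'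
  · obtain ⟨x, x', h, h', hne⟩ := h2
    obtain ⟨u, hu, -⟩ := hP.exists_isDkInterval_of_covBy_covBy h h' hne
    exact ⟨3, le_rfl, u, hu⟩
  -- With a single upper cover `b`, the branching happens at or above `b`, so `b` carries a diamond
  -- by induction; prolonged by `a`, it is completed by (D1).
  · push Not at h2
    simp only [topForest, Set.mem_ofPred_eq, not_forall] at ha
    obtain ⟨y, hay, z, z', hz, hz', hne⟩ := ha
    have hlt : a < y := lt_of_le_of_ne hay (by rintro rfl; exact hne (h2 z z' hz hz'))
    obtain ⟨b, hab, hby⟩ := exists_covBy_le_of_lt hlt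
    have hcov : ∀ z, a < z → b ≤ z := fun z hz => by
      obtain ⟨b', hb', hle⟩ := exists_covBy_le_of_lt hz
      exact (h2 b b' hab hb').trans_le hle
    obtain ⟨k, hk, u, hu⟩ := ih b hab.lt (fun hb => hne (hb y hby z z' hz hz'))
    obtain ⟨w, -, v, hv, hd⟩ := hP.d1 (k + 1) (by omega) _ (hu.isDkMinus_succ hk hab hcov)
    have hau : a ≤ u := hab.le.trans (hu.lt hk).le
    have haI : a ∈ Set.Icc v w := hv ▸ Or.inr ⟨le_rfl, hau⟩
    have hvm : v ∈ insert w (Set.Icc a u) := hv ▸ ⟨le_rfl, haI.1.trans haI.2⟩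
    have hav : a ≤ v := by
      rcases hvm with rfl | h
      · exact haI.2
      · exact h.1
    obtain rfl := le_antisymm hav haI.1
    exact ⟨k + 1, by omega, w, hd⟩

/-- A second cover of `a` spans a `d_3`-interval with `x`; without one, every diamond above `a`
passes through `x`. -/
theorem exists_isDkInterval_of_covBy {a x : P} (ha : a ∉ topForest P) (hx : a ⋖ x) :
    ∃ k, 3 ≤ k ∧ ∃ u, IsDkInterval k a u ∧ x ≤ u := by
  by_cases h : ∃ x', a ⋖ x' ∧ x ≠ x'
  · obtain ⟨x', hx', hne⟩ := h
    obtain ⟨u, hu⟩ := hP.exists_isDkInterval_of_covBy_covBy hx hx' hne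
    exact ⟨3, le_rfl, u, hu⟩
  · push Not at h
    obtain ⟨k, hk, u, hu⟩ := hP.exists_isDkInterval ha
    obtain ⟨x', hx', hle⟩ := exists_covBy_le_of_lt (hu.lt hk)
    exact ⟨k, hk, u, hu, (h x' hx').trans_le hle⟩

end IsDComplete

/-! ### Adjacent colors and comparability -/

namespace IsDCompleteColoring

variable {c : P → I} (hc : IsDCompleteColoring c)
include hc

theorem comparable {x y : P} (h : c x = c y) : x ≤ y ∨ y ≤ x := by
  by_contra hn
  push Not at hn
  exact hc.incomparable x y hn.1 hn.2 h

theorem eq_of_mem_topForest {x y : P} (hx : x ∈ topForest P) (hy : y ∈ topForest P)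
    (h : c x = c y) : x = y :=
  hc.bijOn_topForest.injOn hx hy h

theorem exists_mem_topForest (i : I) : ∃ x ∈ topForest P, c x = i :=
  hc.bijOn_topForest.surjOn (Set.mem_univ i)

theorem colorAdj_iff {x y : P} (hx : x ∈ topForest P) (hy : y ∈ topForest P) :
    ColorAdj c (c x) (c y) ↔ x ⋖ y ∨ y ⋖ x := by
  constructor
  · rintro ⟨x', hx', y', hy', h1, h2, h⟩
    rwa [hc.eq_of_mem_topForest hx' hx h1, hc.eq_of_mem_topForest hy' hy h2] at h
  · exact fun h => ⟨x, hx, y, hy, rfl, rfl, h⟩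

theorem not_colorAdj_self (i : I) : ¬ ColorAdj c i i := by
  obtain ⟨x, hx, rfl⟩ := hc.exists_mem_topForest i
  rw [hc.colorAdj_iff hx hx]
  rintro (h | h) <;> exact lt_irrefl _ h.lt

/-- The color of the ends of a `d_k`-interval does not occur in its interior. -/
theorem color_ne_of_isDkInterval {k : ℕ} (hk : 3 ≤ k) {v u w : P} (h : IsDkInterval k v u)
    (hvw : v < w) (hwu : w < u) : c w ≠ c u := by
  intro hw
  rcases h.isChain_or ⟨hvw.le, hwu.le⟩ with hch | hch
  · exact hvw.ne (hc.chain _ _ hch ⟨le_rfl, hvw.le⟩ ⟨hvw.le, le_rfl⟩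
      ((hc.interval k hk v u h).trans hw.symm))
  · exact hwu.ne (hc.chain _ _ hch ⟨le_rfl, hwu.le⟩ ⟨hwu.le, le_rfl⟩ hw)

theorem not_mem_topForest_of_lt {a b : P} (hab : a < b) (h : c a = c b) : a ∉ topForest P :=
  fun ha => hab.ne (hc.eq_of_mem_topForest ha (topForest_isUpperSet hab.le ha) h)

variable [Finite P] (hP : IsDComplete P)
include hP

/-- The colors of the two elements of a covering pair are adjacent. -/
theorem colorAdj_of_covBy {y x : P} (h : y ⋖ x) : ColorAdj c (c y) (c x) := by
  induction y using WellFoundedGT.induction generalizing x with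
  | ind y ih =>
  by_cases hy : y ∈ topForest P
  · exact (hc.colorAdj_iff hy (topForest_isUpperSet h.le hy)).2 (Or.inl h)
  · obtain ⟨k, hk, u, hu, hxu⟩ := hP.exists_isDkInterval_of_covBy hy h
    have hlt : x < u := by
      refine lt_of_le_of_ne hxu ?_
      rintro rfl
      obtain ⟨w, hw, hwx⟩ := exists_covBy_le_of_lt (hu.lt hk)
      obtain ⟨w', hw', hwx'⟩ := exists_le_covBy_of_lt (hu.lt hk)
      rcases hu.peel hk h le_rfl hw' hwx' with h' | ⟨l, hl, h'⟩
      · exact lt_irrefl _ h'.1.lt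
      · exact lt_asymm (h'.lt hl) hwx'.lt
    -- Since `c y = c u`, peeling the diamond trades `y ⋖ x` for a cover of the same two colors with
    -- a higher lower end.
    obtain ⟨w, hxw, hwu⟩ := exists_le_covBy_of_lt hlt
    rw [hc.interval k hk y u hu]
    rcases hu.peel hk h hxu (h.le.trans hxw) hwu with h' | ⟨l, hl, h'⟩
    · exact (ih x h.lt h'.1).symm
    · rw [hc.interval l hl x w h']
      exact (ih w (h.lt.trans_le hxw) hwu).symm

/-- In an interval that is a chain, only covering pairs have adjacent end colors. -/
theorem covBy_of_isChain {a b : P} (hab : a < b) (hch : IsChain (· ≤ ·) (Set.Icc a b))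
    (hadj : ColorAdj c (c a) (c b)) : a ⋖ b := by
  choose γ hγ hγc using hc.exists_mem_topForest
  have hγadj : ∀ {i j}, ColorAdj c i j → γ i ⋖ γ j ∨ γ j ⋖ γ i := fun {i j} h => by
    rw [← hγc i, ← hγc j] at h
    exact (hc.colorAdj_iff (hγ i) (hγ j)).1 h
  -- If `a ⋖ b` failed, the distinct colors of the chain would close up to a cycle in the forest. A
  -- color minimal in the forest has at most one neighbor on it, since forest elements have at most
  -- one upper cover.
  obtain ⟨z, hz, hmin⟩ := (Set.toFinite (Set.Icc a b)).exists_minimalFor (fun z => γ (c z)) _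
    ⟨a, le_rfl, hab.le⟩
  have hinj := hc.chain a b hch
  have hcov : ∀ {s}, s ∈ Set.Icc a b → ColorAdj c (c z) (c s) → γ (c z) ⋖ γ (c s) := by
    intro s hs h
    rcases hγadj h with h | h
    · exact h
    · exact absurd h.lt (hmin hs h.le).not_gt
  have huniq : ∀ {s t}, s ∈ Set.Icc a b → t ∈ Set.Icc a b → ColorAdj c (c z) (c s) →
      ColorAdj c (c z) (c t) → s = t := by
    intro s t hs ht h1 h2
    refine hinj hs ht ?_
    have := hγ (c z) _ le_rfl _ _ (hcov hs h1) (hcov ht h2)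
    rw [← hγc (c s), ← hγc (c t), this]
  have hup : z < b → ∃ s ∈ Set.Icc a b, z ⋖ s ∧ ColorAdj c (c z) (c s) := fun h => by
    obtain ⟨s, hs, hsb⟩ := exists_covBy_le_of_lt h
    exact ⟨s, ⟨hz.1.trans hs.le, hsb⟩, hs, hc.colorAdj_of_covBy hP hs⟩
  have hdown : a < z → ∃ s ∈ Set.Icc a b, s ⋖ z ∧ ColorAdj c (c z) (c s) := fun h => by
    obtain ⟨s, has, hs⟩ := exists_le_covBy_of_lt h
    exact ⟨s, ⟨has, hs.le.trans hz.2⟩, hs, (hc.colorAdj_of_covBy hP hs).symm⟩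
  rcases eq_or_lt_of_le hz.1 with rfl | h1
  · obtain ⟨s, hs, hzs, hadj'⟩ := hup hab
    rwa [← huniq hs ⟨hab.le, le_rfl⟩ hadj' hadj]
  · obtain ⟨s, hs, hsz, hadj'⟩ := hdown h1
    rcases eq_or_lt_of_le hz.2 with rfl | h2
    · rwa [← huniq hs ⟨le_rfl, hab.le⟩ hadj' hadj.symm]
    · obtain ⟨t, ht, hzt, hadj''⟩ := hup h2
      exact absurd (huniq hs ht hadj' hadj'') (hsz.lt.trans hzt.lt).ne

/-- Everything covered by `b` lies above the smaller elements of the color of `b`. -/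
theorem le_of_covBy {a b z : P} (hab : a < b) (h : c a = c b) (hz : z ⋖ b) : a ≤ z := by
  induction a using WellFoundedGT.induction with
  | ind a ih =>
  -- Climb by diamonds of color `c b`: none contains `b` in its interior, so one has `b` as its top,
  -- and (D2) applies there.
  obtain ⟨k, hk, u, hu⟩ := hP.exists_isDkInterval (hc.not_mem_topForest_of_lt hab h)
  have hcu := hc.interval k hk a u hu
  rcases hc.comparable (hcu.symm.trans h) with hub | hbu
  · rcases eq_or_lt_of_le hub with rfl | hub
    · exact (hP.d2 k hk a u hu z hz).1
    · exact (hu.lt hk).le.trans (ih u (hu.lt hk) hub (hcu.symm.trans h))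
  · rcases eq_or_lt_of_le hbu with rfl | hbu
    · exact (hP.d2 k hk a b hu z hz).1
    · exact absurd (h.symm.trans hcu) (hc.color_ne_of_isDkInterval hk hu hab hbu)

/-- The crossing case of comparability. If `y ⋖ x'` fails, the chain side of `[y, y']` at `x'`
forces `x' ⋖ y'`; peeling then gives an element `t > y` of color `c x'` below `x'`, and `t ≤ x`
because that color does not occur strictly between `x` and `x'`. -/
theorem le_or_le_of_lt_of_lt {k : ℕ} (hk : 3 ≤ k) {x y x' y' : P}
    (hx : x < x') (hxc : c x = c x') (hx' : ∀ z, x < z → z < x' → c z ≠ c x')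
    (hy : IsDkInterval k y y') (h1 : y < x') (h2 : x' < y')
    (hadj : ColorAdj c (c x') (c y')) : x ≤ y ∨ y ≤ x := by
  by_cases hyx : y ⋖ x'
  · exact Or.inl (hc.le_of_covBy hP hx hxc hyx)
  · have hcov : x' ⋖ y' := by
      rcases hy.isChain_or ⟨h1.le, h2.le⟩ with hch | hch
      · rw [← hc.interval k hk y y' hy] at hadj
        exact absurd (hc.covBy_of_isChain hP h1 hch hadj.symm) hyx
      · exact hc.covBy_of_isChain hP h2 hch hadj
    obtain ⟨t, hyt, htx⟩ := exists_covBy_le_of_lt h1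
    rcases hy.peel hk hyt (htx.trans h2.le) h1.le hcov with h' | ⟨l, hl, h'⟩
    · exact absurd h'.2 hyx
    · have hct := hc.interval l hl t x' h'
      rcases hc.comparable (hxc.trans hct.symm) with hxt | htx
      · rcases eq_or_lt_of_le hxt with rfl | hxt
        · exact Or.inr hyt.le
        · exact absurd hct (hx' t hxt (h'.lt hl))
      · rcases eq_or_lt_of_le htx with rfl | htx
        · exact Or.inr hyt.le
        · exact Or.inr (hyt.le.trans htx.le)

/-- Raise `x` to the top `u` of its diamond. If `y < u`, both lie in the top forest, so `y ⋖ u`, and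
`le_of_covBy` puts `x` below `y`. -/
theorem comparable_of_colorAdj_of_mem {x y : P} (hx : x ∉ topForest P) (hy : y ∈ topForest P)
    (hadj : ColorAdj c (c x) (c y)) (ih : ∀ x', x < x' → ColorAdj c (c x') (c y) →
      x' ≤ y ∨ y ≤ x') : x ≤ y ∨ y ≤ x := by
  obtain ⟨k, hk, u, hu⟩ := hP.exists_isDkInterval hx
  have hcu := hc.interval k hk x u hu
  rw [hcu] at hadj
  rcases ih u (hu.lt hk) hadj with h | h
  · exact Or.inl ((hu.lt hk).le.trans h)
  · have hlt : y < u := lt_of_le_of_ne h (by rintro rfl; exact hc.not_colorAdj_self _ hadj)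
    rcases (hc.colorAdj_iff (topForest_isUpperSet h hy) hy).1 hadj with h' | h'
    · exact absurd hlt h'.lt.not_gt
    · exact Or.inl (hc.le_of_covBy hP (hu.lt hk) hcu h')

/-- Elements with adjacent colors are comparable. -/
theorem comparable_of_colorAdj {x y : P} (hadj : ColorAdj c (c x) (c y)) : x ≤ y ∨ y ≤ x := by
  suffices H : ∀ p : P × P, ColorAdj c (c p.1) (c p.2) → p.1 ≤ p.2 ∨ p.2 ≤ p.1 from H (x, y) hadj
  intro p
  induction p using WellFoundedGT.induction with
  | ind p ih =>
  obtain ⟨x, y⟩ := p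
  intro hadj
  simp only at hadj ⊢
  have ihx : ∀ x', x < x' → ColorAdj c (c x') (c y) → x' ≤ y ∨ y ≤ x' :=
    fun x' h h' => ih (x', y) (Prod.mk_lt_mk_iff_left.2 h) h'
  have ihy : ∀ y', y < y' → ColorAdj c (c x) (c y') → x ≤ y' ∨ y' ≤ x :=
    fun y' h h' => ih (x, y') (Prod.mk_lt_mk_iff_right.2 h) h'
  by_cases hx : x ∈ topForest P
  · by_cases hy : y ∈ topForest P
    · exact ((hc.colorAdj_iff hx hy).1 hadj).imp CovBy.le CovBy.le
    · exact (hc.comparable_of_colorAdj_of_mem hP hy hx hadj.symm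
        fun y' h h' => (ihy y' h h'.symm).symm).symm
  · by_cases hy : y ∈ topForest P
    · exact hc.comparable_of_colorAdj_of_mem hP hx hy hadj ihx
    -- Raising either element to the top of its diamond settles everything but `y < x'` and `x <
    -- y'`; comparing `x'` with `y'` then nests one top in the other diamond.
    · obtain ⟨k, hk, x', hx'⟩ := hP.exists_isDkInterval hx
      obtain ⟨l, hl, y', hy'⟩ := hP.exists_isDkInterval hy
      have hcx := hc.interval k hk x x' hx'
      have hcy := hc.interval l hl y y' hy'
      have hadj' : ColorAdj c (c x') (c y') := by rwa [← hcx, ← hcy]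
      have hne : x' ≠ y := by
        rintro rfl
        exact hc.not_colorAdj_self _ (hcx ▸ hadj)
      have hne' : y' ≠ x := by
        rintro rfl
        exact hc.not_colorAdj_self _ (hcy ▸ hadj)
      have hne'' : x' ≠ y' := by
        rintro rfl
        exact hc.not_colorAdj_self _ hadj'
      rcases ihx x' (hx'.lt hk) (hcx ▸ hadj) with h1 | h1
      · exact Or.inl ((hx'.lt hk).le.trans h1)
      rcases ihy y' (hy'.lt hl) (hcy ▸ hadj) with h2 | h2
      swap
      · exact Or.inr ((hy'.lt hl).le.trans h2)
      have h1 := lt_of_le_of_ne h1 hne.symm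
      have h2 := lt_of_le_of_ne h2 hne'.symm
      rcases ih (x', y') (Prod.mk_lt_mk.2 (Or.inl ⟨hx'.lt hk, (hy'.lt hl).le⟩)) hadj' with h | h
      · exact hc.le_or_le_of_lt_of_lt hP hl (hx'.lt hk) hcx
          (fun z => hc.color_ne_of_isDkInterval hk hx') hy' h1 (lt_of_le_of_ne h hne'') hadj'
      · exact (hc.le_or_le_of_lt_of_lt hP hk (hy'.lt hl) hcy
          (fun z => hc.color_ne_of_isDkInterval hl hy') hx' h2 (lt_of_le_of_ne h hne''.symm)
          hadj'.symm).symm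

end IsDCompleteColoring

/-! ### Separated sets and vacated positions -/

/-- Between any two elements of `D` of the same color there is an element of `D` of an adjacent
color. -/
def IsSeparated (c : P → I) (D : Set P) : Prop :=
  ∀ v ∈ D, ∀ u ∈ D, v < u → c v = c u → (Set.Icc v u ∩ D ∩ nbr c (c u)).Nonempty

/-- The positions outside `D` from which an element of `D` of the same color could have slid
down, with no element of an adjacent color in the way. -/
def vacated (c : P → I) (D : Set P) : Set P :=
  {u | u ∉ D ∧ ∃ v ∈ D, v < u ∧ c v = c u ∧ Set.Icc v u ∩ D ∩ nbr c (c u) = ∅}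

theorem inter_nbr_eq_empty_iff {c : P → I} {D : Set P} {v u : P} {i : I} :
    Set.Icc v u ∩ D ∩ nbr c i = ∅ ↔ ∀ z ∈ D, v ≤ z → z ≤ u → ¬ ColorAdj c (c z) i := by
  rw [Set.eq_empty_iff_forall_notMem]
  exact ⟨fun h z hz h1 h2 h3 => h z ⟨⟨⟨h1, h2⟩, hz⟩, h3⟩,
    fun h z hz => h z hz.1.2 hz.1.1.1 hz.1.1.2 hz.2⟩

theorem disjoint_vacated (c : P → I) (D : Set P) : Disjoint D (vacated c D) :=
  Set.disjoint_left.2 fun _ hx hx' => hx'.1 hx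

theorem IsActive.color_ne {c : P → I} (hc : IsDCompleteColoring c) {D : Set P} {u v w : P}
    (h : IsActive c D u v) (hvw : v < w) (hwu : w < u) : c w ≠ c u := by
  obtain ⟨k, hk, hd⟩ := h.interval
  exact hc.color_ne_of_isDkInterval hk hd hvw hwu

theorem IsActive.not_colorAdj {c : P → I} {D : Set P} {u v z : P} (h : IsActive c D u v)
    (hz : z ∈ D) (h1 : v ≤ z) (h2 : z ≤ u) : ¬ ColorAdj c (c z) (c u) :=
  inter_nbr_eq_empty_iff.1 h.inter_eq z hz h1 h2

theorem IsSeparated.exists {c : P → I} {D : Set P} (h : IsSeparated c D) {v u : P} (hv : v ∈ D)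
    (hu : u ∈ D) (hvu : v < u) (hcol : c v = c u) :
    ∃ z ∈ D, v ≤ z ∧ z ≤ u ∧ ColorAdj c (c z) (c u) := by
  obtain ⟨z, ⟨⟨h1, h2⟩, h3⟩, h4⟩ := h v hv u hu hvu hcol
  exact ⟨z, h3, h1, h2, h4⟩

theorem mem_vacated_iff {c : P → I} {D : Set P} {u : P} : u ∈ vacated c D ↔
    u ∉ D ∧ ∃ v ∈ D, v < u ∧ c v = c u ∧
      ∀ z ∈ D, v ≤ z → z ≤ u → ¬ ColorAdj c (c z) (c u) := by
  simp only [vacated, Set.mem_ofPred_eq, inter_nbr_eq_empty_iff]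

theorem vacated_of_isUpperSet (c : P → I) {F : Set P} (hF : IsUpperSet F) : vacated c F = ∅ :=
  Set.eq_empty_iff_forall_notMem.2 fun _ ⟨hu, _, hv, hvu, _⟩ => hu (hF hvu.le hv)

/-- A separated set is determined by its union with a set of vacated positions. -/
theorem IsSeparated.eq_of_union_eq [Finite P] {c : P → I} (hirr : ∀ i, ¬ ColorAdj c i i)
    {D D' S S' : Set P} (hD : IsSeparated c D) (hD' : IsSeparated c D')
    (hS : S ⊆ vacated c D) (hS' : S' ⊆ vacated c D') (h : D ∪ S = D' ∪ S') : D = D' := by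
  -- If `x ∈ D` were a vacated position of `D'`, its witness below would lie in `D` too, and the
  -- element separating the two in `D` would obstruct in `D'`.
  have key : ∀ {D D' S S' : Set P}, IsSeparated c D → S' ⊆ vacated c D' → D ∪ S = D' ∪ S' →
      ∀ x, (∀ y < x, y ∈ D ↔ y ∈ D') → x ∈ D → x ∈ D' := by
    intro D D' S S' hD hS' h x ih hx
    have hx' : x ∈ D' ∪ S' := h ▸ Or.inl hx
    refine hx'.resolve_right fun hxS => ?_
    obtain ⟨-, v, hv, hvx, hcol, hsep⟩ := mem_vacated_iff.1 (hS' hxS)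
    obtain ⟨z, hz, h1, h2, h3⟩ := hD.exists ((ih v hvx).2 hv) hx hvx hcol
    have hzx : z ≠ x := by rintro rfl; exact hirr _ h3
    exact hsep z ((ih z (lt_of_le_of_ne h2 hzx)).1 hz) h1 h2 h3
  ext x
  induction x using WellFoundedLT.induction with
  | ind x ih =>
  exact ⟨key hD hS' h x ih, key hD' hS h.symm x fun y hy => (ih y hy).symm⟩

/-! ### Effect of an elementary excitation -/

namespace IsDCompleteColoring

variable {c : P → I} (hc : IsDCompleteColoring c) [Finite P] (hP : IsDComplete P)
include hc hP

theorem isSeparated_of_isUpperSet {F : Set P} (hF : IsUpperSet F) : IsSeparated c F := by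
  intro v hv u hu hvu hcol
  obtain ⟨x, hx, hxu⟩ := exists_covBy_le_of_lt hvu
  exact ⟨x, ⟨⟨hx.le, hxu⟩, hF hx.le hv⟩, hcol ▸ (hc.colorAdj_of_covBy hP hx).symm⟩

/-- No element of `D` of an adjacent color lies in `[b, a]`, so by comparability what separated `a`
from elements below also separates `b` from them; where `a` was the separator, `b` takes over. -/
theorem isSeparated_excitation {D : Set P} (hD : IsSeparated c D) {a b : P}
    (h : IsActive c D a b) : IsSeparated c (insert b (D \ {a})) := by
  have hb : c b = c a := h.color
  -- it suffices to separate by an element of `D` other than `a`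
  have fin : ∀ {v u z}, z ∈ D → v ≤ z → z ≤ u → ColorAdj c (c z) (c u) → z ≠ a →
      (Set.Icc v u ∩ insert b (D \ {a}) ∩ nbr c (c u)).Nonempty :=
    fun hz h1 h2 h3 hza => ⟨_, ⟨⟨h1, h2⟩, Or.inr ⟨hz, hza⟩⟩, h3⟩
  have hne : ∀ {z}, ColorAdj c (c z) (c a) → z ≠ a := by
    rintro _ hz rfl
    exact hc.not_colorAdj_self _ hz
  rintro v (rfl | ⟨hv, hva⟩) u (rfl | ⟨hu, hua⟩) hvu hcol
  · exact absurd hvu (lt_irrefl _)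
  · have hau : a < u := by
      rcases hc.comparable (hb.symm.trans hcol) with h' | h'
      · exact lt_of_le_of_ne h' (Ne.symm hua)
      · exact absurd (hcol.symm.trans hb) (h.color_ne hc hvu (lt_of_le_of_ne h' hua))
    obtain ⟨z, hz, h1, h2, h3⟩ := hD.exists h.mem hu hau (hb.symm.trans hcol)
    exact fin hz (h.lt.le.trans h1) h2 h3 (hne (hb ▸ hcol ▸ h3))
  · obtain ⟨z, hz, h1, h2, h3⟩ := hD.exists hv h.mem (hvu.trans h.lt) (hcol.trans hb)
    have hzb : z ≤ u := by
      rcases hc.comparable_of_colorAdj hP (hb.symm ▸ h3 : ColorAdj c (c z) (c u)) with h' | h'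
      · exact h'
      · exact absurd h3 (h.not_colorAdj hz h' h2)
    exact fin hz h1 hzb (hb ▸ h3) (hne h3)
  · obtain ⟨z, hz, h1, h2, h3⟩ := hD.exists hv hu hvu hcol
    by_cases hza : z = a
    · subst hza
      refine ⟨b, ⟨⟨?_, h.lt.le.trans h2⟩, Or.inl rfl⟩, by rw [nbr, Set.mem_ofPred_eq, hb]; exact h3⟩
      have hadj : ColorAdj c (c v) (c b) := by rw [hcol, hb]; exact h3.symm
      rcases hc.comparable_of_colorAdj hP hadj with h' | h'
      · exact h'
      · exact absurd (hb ▸ hadj) (h.not_colorAdj hv h' h1)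
    · exact fin hz h1 h2 h3 hza

/-- An elementary excitation changes the set of vacated positions according to the recursion for
excited peaks. -/
theorem vacated_excitation {D : Set P} (hD : IsSeparated c D) {a b : P} (h : IsActive c D a b) :
    vacated c (insert b (D \ {a})) = (vacated c D \ (Set.Icc b a ∩ nbr c (c a))) ∪ {a} := by
  have hb : c b = c a := h.color
  have hcmp : ∀ {x y : P}, ColorAdj c (c x) (c y) → x ≤ y ∨ y ≤ x :=
    fun h => hc.comparable_of_colorAdj hP h
  ext u
  simp only [Set.mem_union, Set.mem_sdiff, Set.mem_singleton_iff, Set.mem_inter_iff, Set.mem_Icc,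
    not_and, mem_vacated_iff, nbr, Set.mem_ofPred_eq, Set.mem_insert_iff]
  constructor
  · rintro ⟨hu, v, hv, hvu, hcol, hsep⟩
    rw [or_iff_not_imp_right]
    intro hua
    push Not at hu
    have huD : u ∉ D := fun hu' => hua (hu.2 hu')
    -- Back in `D`, `a` replaces `b` as witness; where `a` would obstruct, so would `b` in the new
    -- set.
    rcases hv with rfl | ⟨hv, hva⟩
    · refine ⟨⟨huD, a, h.mem, ?_, hb.symm.trans hcol, ?_⟩, ?_⟩
      · rcases hc.comparable (hb.symm.trans hcol) with h' | h'
        · exact lt_of_le_of_ne h' (Ne.symm hua)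
        · exact absurd (hcol.symm.trans hb) (h.color_ne hc hvu (lt_of_le_of_ne h' hua))
      · intro z hz h1 h2 h3
        refine hsep z (Or.inr ⟨hz, ?_⟩) (h.lt.le.trans h1) h2 h3
        rintro rfl
        rw [← hcol, hb] at h3
        exact hc.not_colorAdj_self _ h3
      · rintro - h3
        rw [← hcol, hb] at h3
        exact hc.not_colorAdj_self _ h3
    · refine ⟨⟨huD, v, hv, hvu, hcol, ?_⟩, ?_⟩
      · intro z hz h1 h2 h3
        by_cases hza : z = a
        · subst hza
          have hadj : ColorAdj c (c v) (c b) := by rw [hcol, hb]; exact h3.symm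
          rcases hcmp hadj with h' | h'
          · exact hsep b (Or.inl rfl) h' (h.lt.le.trans h2) (hb ▸ h3)
          · exact h.not_colorAdj hv h' h1 (hb ▸ hadj)
        · exact hsep z (Or.inr ⟨hz, hza⟩) h1 h2 h3
      · rintro ⟨h1, h2⟩ h3
        have hadj : ColorAdj c (c v) (c b) := by rwa [hcol, hb]
        rcases hcmp hadj with h' | h'
        · refine hsep b (Or.inl rfl) h' h1 ?_
          rw [hb]
          exact h3.symm
        · exact h.not_colorAdj hv h' (hvu.le.trans h2) (hb ▸ hadj)
  · rintro (⟨⟨hu, v, hv, hvu, hcol, hsep⟩, hN⟩ | rfl)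
    · have hua : u ≠ a := by rintro rfl; exact hu h.mem
      have hub : u ≠ b := by
        -- If `b` were vacated in `D`, an element separating its witness from `a` would obstruct
        -- either that vacancy or the excitation.
        rintro rfl
        obtain ⟨z, hz, h1, h2, h3⟩ := hD.exists hv h.mem (hvu.trans h.lt) (hcol.trans hb)
        have hadj : ColorAdj c (c z) (c u) := by rwa [hb]
        rcases hcmp hadj with h' | h'
        · exact hsep z hz h1 h' hadj
        · exact h.not_colorAdj hz h' h2 h3
      refine ⟨by tauto, ?_⟩
      by_cases hva : v = a
      · subst hva
        refine ⟨b, Or.inl rfl, h.lt.trans hvu, hb.trans hcol, ?_⟩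
        rintro z (rfl | ⟨hz, -⟩) h1 h2 h3
        · rw [hb, hcol] at h3
          exact hc.not_colorAdj_self _ h3
        · have hadj : ColorAdj c (c z) (c v) := by rwa [hcol]
          rcases hcmp hadj with h' | h'
          · exact h.not_colorAdj hz h1 h' hadj
          · exact hsep z hz h' h2 h3
      · refine ⟨v, Or.inr ⟨hv, hva⟩, hvu, hcol, ?_⟩
        rintro z (rfl | ⟨hz, -⟩) h1 h2 h3
        · rw [hb] at h3
          -- If `b` obstructs, then either `a` already did in `D`, or `u` lies in `[b, a]` and was
          -- removed by the recursion.
          rcases hcmp h3 with h' | h'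
          · exact hsep a h.mem (h1.trans h.lt.le) h' h3
          · exact hN ⟨h2, h'⟩ h3.symm
        · exact hsep z hz h1 h2 h3
    · refine ⟨?_, b, Or.inl rfl, h.lt, hb, ?_⟩
      · rintro (h' | h')
        · exact h.lt.ne h'.symm
        · exact h'.2 rfl
      · rintro z (rfl | ⟨hz, -⟩) h1 h2 h3
        · rw [hb] at h3
          exact hc.not_colorAdj_self _ h3
        · exact h.not_colorAdj hz h1 h2 h3

/-! ### Excited diagrams and their K-theoretical versions -/

variable {F : Set P} (hF : IsUpperSet F)
include hF

theorem isSeparated_of_mem_excitedDiagrams {D : Set P} (hD : D ∈ excitedDiagrams c F) :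
    IsSeparated c D := by
  induction hD with
  | refl => exact hc.isSeparated_of_isUpperSet hP hF
  | tail _ h ih =>
    obtain ⟨u, v, h, rfl⟩ := h
    exact hc.isSeparated_excitation hP ih h

theorem isPeakSet_iff {D B : Set P} :
    IsPeakSet c F D B ↔ D ∈ excitedDiagrams c F ∧ B = vacated c D := by
  constructor
  · intro h
    induction h with
    | base => exact ⟨.refl, (vacated_of_isUpperSet c hF).symm⟩
    | step _ h ih =>
      obtain ⟨hD, rfl⟩ := ih
      exact ⟨hD.tail ⟨_, _, h, rfl⟩, (hc.vacated_excitation hP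
        (hc.isSeparated_of_mem_excitedDiagrams hP hF hD) h).symm⟩
  · rintro ⟨hD, rfl⟩
    induction hD with
    | refl =>
      rw [vacated_of_isUpperSet c hF]
      exact .base
    | tail hD h ih =>
      obtain ⟨u, v, h, rfl⟩ := h
      rw [hc.vacated_excitation hP (hc.isSeparated_of_mem_excitedDiagrams hP hF hD) h]
      exact .step ih h

theorem excitedPeaks_eq {D : Set P} (hD : D ∈ excitedDiagrams c F) :
    excitedPeaks c F D = vacated c D := by
  have : {B | IsPeakSet c F D B} = {vacated c D} := by
    ext B
    simp [hc.isPeakSet_iff hP hF, hD]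
  rw [excitedPeaks, this, Set.sUnion_singleton]

theorem exists_of_mem_kExcitedDiagrams {E : Set P} (hE : E ∈ kExcitedDiagrams c F) :
    ∃ D ∈ excitedDiagrams c F, ∃ S ⊆ vacated c D, E = D ∪ S := by
  induction hE with
  | refl => exact ⟨F, .refl, ∅, Set.empty_subset _, (Set.union_empty F).symm⟩
  | tail _ h ih =>
    obtain ⟨D, hD, S, hS, rfl⟩ := ih
    obtain ⟨u, v, h, hE⟩ : ∃ u v, IsActive c (D ∪ S) u v ∧
        (_ = insert v ((D ∪ S) \ {u}) ∨ _ = insert v (D ∪ S)) := by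
      rcases h with ⟨u, v, h, hE⟩ | ⟨u, v, h, hE⟩
      · exact ⟨u, v, h, Or.inl hE⟩
      · exact ⟨u, v, h, Or.inr hE⟩
    have hsep := hc.isSeparated_of_mem_excitedDiagrams hP hF hD
    have hvD : v ∉ D := fun hv => h.not_mem (Or.inl hv)
    rcases h.mem with hu | hu
    · have h' : IsActive c D u v := ⟨hu, hvD, h.color, h.lt, h.interval,
        inter_nbr_eq_empty_iff.2 fun z hz => h.not_colorAdj (Or.inl hz)⟩
      have huS : u ∉ S := fun hu' => (hS hu').1 hu
      -- Activity in `D ∪ S` keeps `S` away from the peaks that the excitation deletes.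
      have hS' : S ⊆ vacated c D \ (Set.Icc v u ∩ nbr c (c u)) := fun z hz =>
        ⟨hS hz, fun hz' => h.not_colorAdj (Or.inr hz) hz'.1.1 hz'.1.2 hz'.2⟩
      refine ⟨insert v (D \ {u}), hD.tail ⟨u, v, h', rfl⟩, ?_⟩
      rw [hc.vacated_excitation hP hsep h']
      rcases hE with rfl | rfl
      · refine ⟨S, hS'.trans Set.subset_union_left, ?_⟩
        rw [Set.insert_union, Set.union_sdiff_distrib, Set.sdiff_singleton_eq_self huS]
      · refine ⟨S ∪ {u}, Set.union_subset_union_left _ hS', ?_⟩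
        rw [Set.insert_union, Set.union_comm S, ← Set.union_assoc, Set.sdiff_union_self,
          Set.union_eq_self_of_subset_right (Set.singleton_subset_iff.2 hu)]
    -- Moving a peak leaves `D` alone: the witness `w` for `u` lies below `v`, since `c u` does not
    -- occur inside `[v, u]`, so it serves for `v` too.
    · obtain ⟨huD, w, hw, hwu, hcol, hwN⟩ := mem_vacated_iff.1 (hS hu)
      have hvac : v ∈ vacated c D := by
        refine mem_vacated_iff.2 ⟨hvD, w, hw, ?_, hcol.trans h.color.symm, ?_⟩
        · have hwv : w ≠ v := by rintro rfl; exact hvD hw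
          rcases hc.comparable (hcol.trans h.color.symm) with h' | h'
          · exact lt_of_le_of_ne h' hwv
          · exact absurd hcol (h.color_ne hc (lt_of_le_of_ne h' hwv.symm) hwu)
        · intro z hz h1 h2
          rw [h.color]
          exact hwN z hz h1 (h2.trans h.lt.le)
      refine ⟨D, hD, ?_⟩
      rcases hE with rfl | rfl
      · refine ⟨insert v (S \ {u}),
          Set.insert_subset hvac (Set.sdiff_subset.trans hS), ?_⟩
        rw [Set.union_insert, Set.union_sdiff_distrib, Set.sdiff_singleton_eq_self huD]
      · exact ⟨insert v S, Set.insert_subset hvac hS, Set.union_insert.symm⟩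

/-- Replay the excitations leading to `D`, using the K-theoretical move exactly when the position
`u` being left must remain in `S`. -/
theorem union_mem_kExcitedDiagrams {D : Set P} (hD : D ∈ excitedDiagrams c F) {S : Set P}
    (hS : S ⊆ vacated c D) : D ∪ S ∈ kExcitedDiagrams c F := by
  induction hD generalizing S with
  | refl =>
    rw [vacated_of_isUpperSet c hF, Set.subset_empty_iff] at hS
    rw [hS, Set.union_empty]
    exact .refl
  | @tail D _ hD h ih =>
    obtain ⟨u, v, h, rfl⟩ := h
    have hvS : v ∉ S := fun hv => (hS hv).1 (Or.inl rfl)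
    rw [hc.vacated_excitation hP (hc.isSeparated_of_mem_excitedDiagrams hP hF hD) h] at hS
    have hS' : S \ {u} ⊆ vacated c D \ (Set.Icc v u ∩ nbr c (c u)) :=
      fun z hz => (hS hz.1).resolve_right hz.2
    have hE := ih (hS'.trans Set.sdiff_subset)
    have h' : IsActive c (D ∪ S \ {u}) u v := by
      refine ⟨Or.inl h.mem, ?_, h.color, h.lt, h.interval, inter_nbr_eq_empty_iff.2 ?_⟩
      · rintro (hv | hv)
        · exact h.not_mem hv
        · exact hvS hv.1
      · rintro z (hz | hz) h1 h2 h3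
        · exact h.not_colorAdj hz h1 h2 h3
        · exact (hS' hz).2 ⟨⟨h1, h2⟩, h3⟩
    by_cases hu : u ∈ S
    · refine hE.tail (Or.inr ⟨u, v, h', ?_⟩)
      rw [Set.insert_union]
      congr 1
      ext z
      by_cases hz : z = u
      · subst hz
        simp [hu, h.mem]
      · simp [hz]
    · refine hE.tail (Or.inl ⟨u, v, h', ?_⟩)
      rw [Set.insert_union, Set.union_sdiff_distrib, Set.sdiff_singleton_eq_self hu,
        Set.sdiff_singleton_eq_self hu]

end IsDCompleteColoring

end DComplete

theorem mainTheorem1 {P : Type*} [PartialOrder P] [Finite P]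
    (hP : DComplete.IsDComplete P) (hconn : (SimpleGraph.hasse P).Connected)
    {I : Type*} (c : P → I) (hc : DComplete.IsDCompleteColoring c)
    (F : Set P) (hF : IsUpperSet F) :
    (∀ D ∈ DComplete.excitedDiagrams c F, ∃! B, DComplete.IsPeakSet c F D B) ∧
    (∀ D ∈ DComplete.excitedDiagrams c F, Disjoint D (DComplete.excitedPeaks c F D)) ∧
    DComplete.kExcitedDiagrams c F =
      ⋃ D ∈ DComplete.excitedDiagrams c F,
        {E | ∃ S ⊆ DComplete.excitedPeaks c F D, E = D ∪ S} ∧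
    (DComplete.excitedDiagrams c F).PairwiseDisjoint
      (fun D => {E : Set P | ∃ S ⊆ DComplete.excitedPeaks c F D, E = D ∪ S}) := by
  refine ⟨fun D hD => ?_, fun D hD => ?_, ?_, ?_⟩
  · exact ⟨_, (hc.isPeakSet_iff hP hF).2 ⟨hD, rfl⟩, fun B hB => ((hc.isPeakSet_iff hP hF).1 hB).2⟩
  · rw [hc.excitedPeaks_eq hP hF hD]
    exact DComplete.disjoint_vacated c D
  · ext E
    simp only [Set.mem_iUnion, Set.mem_ofPred_eq, exists_prop]
    constructor
    · intro hE
      obtain ⟨D, hD, S, hS, rfl⟩ := hc.exists_of_mem_kExcitedDiagrams hP hF hE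
      exact ⟨D, hD, S, hS.trans (hc.excitedPeaks_eq hP hF hD).ge, rfl⟩
    · rintro ⟨D, hD, S, hS, rfl⟩
      exact hc.union_mem_kExcitedDiagrams hP hF hD (hS.trans (hc.excitedPeaks_eq hP hF hD).le)
  · intro D hD D' hD' hne
    refine Set.disjoint_left.2 ?_
    rintro E ⟨S, hS, rfl⟩ ⟨S', hS', h⟩
    rw [hc.excitedPeaks_eq hP hF hD] at hS
    rw [hc.excitedPeaks_eq hP hF hD'] at hS'
    exact hne (DComplete.IsSeparated.eq_of_union_eq hc.not_colorAdj_self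
      (hc.isSeparated_of_mem_excitedDiagrams hP hF hD)
      (hc.isSeparated_of_mem_excitedDiagrams hP hF hD') hS hS' h)
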